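/- Let $d\ge 1$ be an integer, let $\mathbb{Z}_d$ be the group of integers modulo $d$, and let $\ell^2(\mathbb{Z}_d)$ be the space of functions $\mathbb{Z}_d\to\mathbb{C}$ with inner product $\langle f,g\rangle=\sum_{i\in\mathbb{Z}_d} f(i)\overline{g(i)}$; let $e_i$ denote the characteristic function of $\{i\}$. A finite sequence $(g_j)$ in $\ell^2(\mathbb{Z}_d)$ is a *frame* if there are constants $\alpha,\beta>0$ with $\alpha\|f\|^2\le\sum_j|\langle f,g_j\rangle|^2\le\beta\|f\|^2$ for all $f\in\ell^2(\mathbb{Z}_d)$. A *circular convolution operator* is an operator $A$ of the form $(Af)(k)=\sum_{i\in\mathbb{Z}_d}a(i)f(k-i)$ for some $a:\mathbb{Z}_d\to\mathbb{C}$; let $N_A$ be the number of distinct eigenvalues of $A$, and $M_A$ the largest geometric multiplicity of an eigenvalue of $A$. For an integer $L\ge 0$ let $\mathcal{A}_L$ be the set of circular convolution operators $A$ on $\ell^2(\mathbb{Z}_d)$ with $M_A=L$. A set $\Omega\subset\mathbb{Z}_d$ is *uniformly distributed over the divisors of $d$* if, for every divisor $m\ge 1$ of $d$, each of the $m$ cosets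 in $\mathbb{Z}_d$ of the subgroup $\langle m\rangle$ generated by $m$ contains exactly $\lfloor|\Omega|/m\rfloor$ or $\lceil|\Omega|/m\rceil$ elements of $\Omega$. Let $\Omega\subset\mathbb{Z}_d$ with $|\Omega|=L$, and for $A\in\mathcal{A}_L$ put $$Y_A=\{e_i,\,Ae_i,\,\dots,\,A^{N_A-1}e_i : i\in\Omega\}.$$ 1. If $d$ is prime, then $Y_A$ is a frame for $\ell^2(\mathbb{Z}_d)$ for every $A\in\mathcal{A}_L$. 2. If $d$ is a power of a prime ($d=p^k$ with $p$ prime and $k\ge 0$), then $Y_A$ is a frame for $\ell^2(\mathbb{Z}_d)$ for every $A\in\mathcal{A}_L$ if and only if $\Omega$ is uniformly distributed over the divisors of $d$. -/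

import Mathlib

/-- A finite family `g` in an inner product space is a frame: there are bounds `0 < a`, `0 < b`
with `a ‖f‖² ≤ ∑ⱼ |⟨f, gⱼ⟩|² ≤ b ‖f‖²` for all `f`.
(Mathlib's inner product is linear in its second argument, so `⟨f, g⟩` is `inner ℂ g f`.) -/
def IsFiniteFrame {ι E : Type*} [Fintype ι] [NormedAddCommGroup E] [InnerProductSpace ℂ E]
    (g : ι → E) : Prop :=
  ∃ a b : ℝ, 0 < a ∧ 0 < b ∧ ∀ f : E,
    a * ‖f‖ ^ 2 ≤ ∑ j, ‖inner ℂ (g j) f‖ ^ 2 ∧ ∑ j, ‖inner ℂ (g j) f‖ ^ 2 ≤ b * ‖f‖ ^ 2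

/-- The circular convolution operator with kernel `a` on `ℓ²(I)`, for a finite abelian group `I`:
`(A f)(k) = ∑ i, a(i) f(k - i)`. -/
noncomputable def circularConvolution {I : Type*} [Fintype I] [AddCommGroup I] (a : I → ℂ) :
    Module.End ℂ (EuclideanSpace ℂ I) where
  toFun f := WithLp.toLp 2 fun k => ∑ i, a i * f (k - i)
  map_add' f g := by
    ext k
    simp [mul_add, Finset.sum_add_distrib]
  map_smul' c f := by
    ext k
    simp [Finset.mul_sum, mul_left_comm]

/-- The number `N_A` of distinct eigenvalues of `A`. -/
noncomputable def numEigenvalues {V : Type*} [AddCommGroup V] [Module ℂ V]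
    (A : Module.End ℂ V) : ℕ :=
  {μ : ℂ | A.HasEigenvalue μ}.ncard

/-- The largest geometric multiplicity `M_A` among all eigenvalues of `A`
(for `V` nonzero and finite-dimensional: the supremum of a nonempty bounded set). -/
noncomputable def maxGeomMultiplicity {V : Type*} [AddCommGroup V] [Module ℂ V]
    (A : Module.End ℂ V) : ℕ :=
  sSup ((fun μ : ℂ => Module.finrank ℂ (A.eigenspace μ)) '' {μ : ℂ | A.HasEigenvalue μ})

/-- The class `𝒜_L` of circular convolution operators on `ℓ²(ℤ_d)` whose eigenvalues have largest
geometric multiplicity `L`. -/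
def convolutionClass (d L : ℕ) [NeZero d] : Set (Module.End ℂ (EuclideanSpace ℂ (ZMod d))) :=
  {A | (∃ a : ZMod d → ℂ, A = circularConvolution a) ∧ maxGeomMultiplicity A = L}

/-- The finite system `Y = {e_i, A e_i, …, A^(N_A - 1) e_i : i ∈ Ω}`. -/
noncomputable def samplingSystem {d : ℕ} [NeZero d]
    (A : Module.End ℂ (EuclideanSpace ℂ (ZMod d))) (Ω : Finset (ZMod d)) :
    Ω × Fin (numEigenvalues A) → EuclideanSpace ℂ (ZMod d) :=
  fun p => (A ^ (p.2 : ℕ)) (EuclideanSpace.single (p.1 : ZMod d) 1)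

/-- `Ω ⊆ ℤ_d` is uniformly distributed over the divisors of `d`: for every divisor `m` of `d`, every
coset `c + ⟨m⟩` of the subgroup generated by `m` meets `Ω` in `⌊|Ω| / m⌋` or `⌈|Ω| / m⌉`
elements. -/
def UniformlyDistributedOverDivisors {d : ℕ} (Ω : Finset (ZMod d)) : Prop :=
  ∀ m : ℕ, m ∣ d → ∀ c : ZMod d,
    {i : ZMod d | i ∈ Ω ∧ i - c ∈ AddSubgroup.zmultiples (m : ZMod d)}.ncard
      ∈ ({Ω.card / m, Ω.card ⌈/⌉ m} : Set ℕ)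

/-!
The characters of `ℤ_d` diagonalize every circular convolution operator, and the eigenvalues form an
arbitrary function on the frequencies, namely the Fourier transform of the kernel. Separating the
distinct eigenvalues by interpolation shows that the iterated system over `Ω` is a frame if and only
if, for each eigenvalue, the characters belonging to it are linearly independent on `Ω`
(`isFiniteFrame_samplingSystem_iff`). Since the largest level set has `L = |Ω|` elements and may be
any set of that size, all systems in the class are frames exactly when `Ω` is a universal sampling
set: every square submatrix of the Fourier matrix with rows `Ω` is invertible.

That a universal sampling set is uniformly distributed holds for every `d`. Let `m` divide `d`, and
take the frequencies to fill the residue classes modulo `d / m` one after the other. They meet only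
`⌈L/m⌉` classes, and characters in the same class are proportional on a coset of `⟨m⟩`, so a coset
with more points gives dependent rows (`IsUniversalSampling.card_coset_le`). They fill `⌊L/m⌋`
classes completely, and the characters of a full class combine to functions supported on a single
coset, so a coset with fewer points gives dependent columns (`IsUniversalSampling.le_card_coset`).

Conversely let `d = p ^ k`. A dependence between the rows is a polynomial with `L` monomials, with
exponents in `Ω`, vanishing at `L` distinct `d`-th roots of unity. Over a valuation ring of `ℂ`
above `p`, after scaling, it reduces to a nonzero polynomial over a field of characteristic `p`, where all
`d`-th roots of unity collapse to `1`; so the reduction is divisible by `(X - 1) ^ L`. This is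
excluded if the determinant of the binomial coefficients `ω.choose j` (`ω ∈ Ω`, `j < L`) is prime to
`p` (`eq_zero_of_eval_rootsOfUnity_eq_zero`). That determinant is the quotient of the Vandermonde
determinants of `Ω` and of `0, …, L - 1`, and the `p`-adic valuation of a Vandermonde determinant
counts the pairs of nodes congruent modulo the powers of `p`. Uniform distribution makes the two
counts equal (`not_dvd_det_choose_of_balanced`). For prime `d` every `Ω` is uniformly distributed.
-/

open scoped ZMod

/-! ### Binomial determinants modulo a prime -/

/-- Clearing denominators in the columns of the matrix of binomial coefficients turns it into a
Vandermonde matrix up to unitriangular column operations. -/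
theorem det_vandermonde_eq_prod_factorial_mul_det_choose {n : ℕ} (w : Fin n → ℕ) :
    (Matrix.vandermonde fun i => (w i : ℤ)).det =
      (∏ j : Fin n, ((j : ℕ).factorial : ℤ)) *
        (Matrix.of fun i j : Fin n => ((w i).choose j : ℤ)).det := by
  rw [Matrix.det_eval_matrixOfPolynomials_eq_det_vandermonde _ (fun j => descPochhammer ℤ j)
    (fun j => descPochhammer_natDegree ℤ j) (fun j => monic_descPochhammer ℤ j),
    ← Matrix.det_mul_row]
  congr 1
  ext i j
  simp only [Matrix.of_apply]
  rw [descPochhammer_eval_eq_descFactorial, Nat.descFactorial_eq_factorial_mul_choose, Nat.cast_mul]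

theorem det_vandermonde_val_eq_prod_factorial (n : ℕ) :
    (Matrix.vandermonde fun i : Fin n => ((i : ℕ) : ℤ)).det =
      ∏ j : Fin n, ((j : ℕ).factorial : ℤ) := by
  rw [det_vandermonde_eq_prod_factorial_mul_det_choose, Matrix.det_of_isLowerTriangular]
  · simp
  · intro i j hij
    simpa using Nat.choose_eq_zero_of_lt (show (i : ℕ) < j from hij)

/-- The exponent of `p` in a Vandermonde determinant counts the pairs of nodes congruent modulo
`p ^ t`, summed over `t`. -/
theorem factorization_natAbs_det_vandermonde {p k n : ℕ} (hp : p.Prime) {w : Fin n → ℕ}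
    (hw : Function.Injective w) (hlt : ∀ i, w i < p ^ k) :
    (Matrix.vandermonde fun i => (w i : ℤ)).det.natAbs.factorization p =
      ∑ t ∈ Finset.Ico 1 k,
        (Finset.univ.filter fun x : Fin n × Fin n =>
          x.1 < x.2 ∧ w x.1 ≡ w x.2 [MOD p ^ t]).card := by
  have hdet : (Matrix.vandermonde fun i => (w i : ℤ)).det.natAbs =
      ∏ x ∈ Finset.univ.filter (fun x : Fin n × Fin n => x.1 < x.2),
        ((w x.2 : ℤ) - w x.1).natAbs := by
    rw [Matrix.det_vandermonde, ← Int.natAbsHom_apply, map_prod, Finset.prod_filter,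
      Fintype.prod_prod_type]
    refine Finset.prod_congr rfl fun i _ => ?_
    rw [map_prod, ← Finset.prod_filter]
    refine Finset.prod_congr ?_ fun j _ => rfl
    ext j
    simp
  have hne : ∀ x ∈ Finset.univ.filter (fun x : Fin n × Fin n => x.1 < x.2),
      ((w x.2 : ℤ) - w x.1).natAbs ≠ 0 := by
    intro x hx h
    have h1 : x.1 < x.2 := by simpa using hx
    have h2 : w x.2 = w x.1 := by omega
    exact h1.ne' (hw h2)
  rw [hdet, Nat.factorization_prod_apply hne]
  have hstep : ∀ x ∈ Finset.univ.filter (fun x : Fin n × Fin n => x.1 < x.2),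
      (((w x.2 : ℤ) - w x.1).natAbs).factorization p =
        ∑ t ∈ Finset.Ico 1 k, if w x.1 ≡ w x.2 [MOD p ^ t] then 1 else 0 := by
    intro x hx
    rw [Nat.factorization_eq_card_pow_dvd_of_lt (b := k) hp (Nat.pos_of_ne_zero (hne x hx))
      (by have := hlt x.1; have := hlt x.2; omega), Finset.card_filter]
    refine Finset.sum_congr rfl fun t _ => ?_
    congr 1
    rw [eq_iff_iff, Nat.modEq_iff_dvd, Int.natCast_dvd]
  rw [Finset.sum_congr rfl hstep, Finset.sum_comm]
  refine Finset.sum_congr rfl fun t _ => ?_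
  rw [Finset.card_filter, Finset.sum_filter]
  refine Finset.sum_congr rfl fun x _ => ?_
  by_cases h1 : x.1 < x.2 <;> simp [h1]

/-- If the residue class counts of a family are all `⌊n/m⌋` or `⌊n/m⌋ + 1`, then the number of
congruent pairs depends on `n` and `m` only, because `c ^ 2` is an affine function of `c` on two
consecutive integers. -/
theorem card_lt_modEq_of_balanced {n m q : ℕ} (hm : 0 < m) {w : Fin n → ℕ}
    (h : ∀ c < m, (Finset.univ.filter fun i => w i % m = c).card = q ∨
      (Finset.univ.filter fun i => w i % m = c).card = q + 1) :
    (2 * (Finset.univ.filter fun x : Fin n × Fin n =>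
      x.1 < x.2 ∧ w x.1 ≡ w x.2 [MOD m]).card : ℤ) = 2 * q * n - m * (q * (q + 1)) := by
  have hsum : n = ∑ c ∈ Finset.range m, (Finset.univ.filter fun i => w i % m = c).card := by
    rw [← Finset.card_eq_sum_card_fiberwise (f := fun i => w i % m) (s := Finset.univ)]
    · simp
    · intro i _
      simpa using Nat.mod_lt _ hm
  have hsq : (Finset.univ.filter fun x : Fin n × Fin n => w x.1 ≡ w x.2 [MOD m]).card =
      ∑ c ∈ Finset.range m, (Finset.univ.filter fun i => w i % m = c).card ^ 2 := by
    rw [Finset.card_eq_sum_card_fiberwise (f := fun x : Fin n × Fin n => w x.1 % m)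
      (t := Finset.range m)]
    · refine Finset.sum_congr rfl fun c _ => ?_
      rw [sq, ← Finset.card_product]
      congr 1
      ext x
      rw [Finset.mem_filter, Finset.mem_filter_univ, Finset.mem_product, Finset.mem_filter_univ,
        Finset.mem_filter_univ]
      exact ⟨fun ⟨h1, h2⟩ => ⟨h2, Eq.trans (Eq.symm h1) h2⟩, fun ⟨h1, h2⟩ => ⟨h1.trans h2.symm, h1⟩⟩
    · intro i _
      simpa using Nat.mod_lt _ hm
  have hsplit : (Finset.univ.filter fun x : Fin n × Fin n => w x.1 ≡ w x.2 [MOD m]).card =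
      2 * (Finset.univ.filter fun x : Fin n × Fin n =>
        x.1 < x.2 ∧ w x.1 ≡ w x.2 [MOD m]).card + n := by
    have hswap : (Finset.univ.filter fun x : Fin n × Fin n =>
        x.2 < x.1 ∧ w x.1 ≡ w x.2 [MOD m]).card = (Finset.univ.filter fun x : Fin n × Fin n =>
        x.1 < x.2 ∧ w x.1 ≡ w x.2 [MOD m]).card := by
      refine Finset.card_equiv (Equiv.prodComm _ _) fun x => ?_
      simp [Nat.ModEq.comm]
    have hdiag : (Finset.univ.filter fun x : Fin n × Fin n => x.1 = x.2).card = n := by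
      have : (Finset.univ.filter fun x : Fin n × Fin n => x.1 = x.2) =
          (Finset.univ : Finset (Fin n)).diag := by
        ext x; simp
      rw [this, Finset.diag_card]; simp
    rw [two_mul]
    nth_rewrite 2 [← hswap]
    refine Eq.trans ?_ (congrArg (_ + ·) hdiag)
    simp only [Finset.card_filter]
    rw [← Finset.sum_add_distrib, ← Finset.sum_add_distrib]
    refine Finset.sum_congr rfl fun x _ => ?_
    rcases lt_trichotomy x.1 x.2 with hx | hx | hx
    · simp [hx, hx.not_gt, hx.ne]
    · simp [hx, Nat.ModEq.refl]
    · simp [hx, hx.not_gt, hx.ne']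
  have hsqZ : (∑ c ∈ Finset.range m, ((Finset.univ.filter fun i => w i % m = c).card : ℤ) ^ 2) =
      (2 * q + 1) * n - m * (q * (q + 1)) := by
    have : ∀ c ∈ Finset.range m, ((Finset.univ.filter fun i => w i % m = c).card : ℤ) ^ 2 =
        (2 * q + 1) * (Finset.univ.filter fun i => w i % m = c).card - q * (q + 1) := by
      intro c hc
      rcases h c (Finset.mem_range.mp hc) with hc | hc <;> rw [hc] <;> push_cast <;> ring
    rw [Finset.sum_congr rfl this, Finset.sum_sub_distrib, ← Finset.mul_sum, ← Nat.cast_sum,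
      ← hsum]
    simp
  have hcast : ((Finset.univ.filter fun x : Fin n × Fin n => w x.1 ≡ w x.2 [MOD m]).card : ℤ) =
      (2 * q + 1) * n - m * (q * (q + 1)) := by
    rw [hsq, ← hsqZ]; push_cast; rfl
  rw [hsplit] at hcast
  push_cast at hcast
  linarith

/-- If a family of `n` distinct natural numbers below `p ^ k` is as equidistributed modulo each
`p ^ t` as `0, …, n - 1` is, then its matrix of binomial coefficients is invertible modulo `p`. -/
theorem not_dvd_det_choose_of_balanced {p k n : ℕ} (hp : p.Prime) {w : Fin n → ℕ}
    (hw : Function.Injective w) (hlt : ∀ i, w i < p ^ k)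
    (hbal : ∀ t ≤ k, ∀ c < p ^ t,
      (Finset.univ.filter fun i => w i % p ^ t = c).card = n / p ^ t ∨
      (Finset.univ.filter fun i => w i % p ^ t = c).card = n / p ^ t + 1) :
    ¬ (p : ℤ) ∣ (Matrix.of fun i j : Fin n => ((w i).choose j : ℤ)).det := by
  have hnk : n ≤ p ^ k := by
    have := Finset.card_le_card_of_injOn (s := Finset.univ) (t := Finset.range (p ^ k)) w
      (fun i _ => by simpa using hlt i) hw.injOn
    simpa using this
  have hval : ∀ t, ∀ c < p ^ t,
      (Finset.univ.filter fun i : Fin n => (i : ℕ) % p ^ t = c).card = n / p ^ t ∨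
      (Finset.univ.filter fun i : Fin n => (i : ℕ) % p ^ t = c).card = n / p ^ t + 1 := by
    intro t c hc
    have h1 : (Finset.univ.filter fun i : Fin n => (i : ℕ) % p ^ t = c).card =
        n.count (· ≡ c [MOD p ^ t]) := by
      rw [Nat.count_eq_card_filter_range, ← Finset.card_map Fin.valEmbedding]
      congr 1
      ext x
      simp only [Finset.mem_map, Finset.mem_filter, Finset.mem_univ, true_and, Finset.mem_range,
        Fin.valEmbedding_apply, Nat.ModEq, Nat.mod_eq_of_lt hc]
      exact ⟨fun ⟨a, h1, h2⟩ => h2 ▸ ⟨a.2, h1⟩, fun ⟨h1, h2⟩ => ⟨⟨x, h1⟩, h2, rfl⟩⟩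
    rw [h1, Nat.count_modEq_card _ (pow_pos hp.pos t)]
    split_ifs <;> simp
  have hfac : (Matrix.vandermonde fun i => (w i : ℤ)).det.natAbs.factorization p =
      (Matrix.vandermonde fun i : Fin n => ((i : ℕ) : ℤ)).det.natAbs.factorization p := by
    rw [factorization_natAbs_det_vandermonde hp hw hlt,
      factorization_natAbs_det_vandermonde (w := fun i : Fin n => (i : ℕ)) hp Fin.val_injective
        (fun i => i.2.trans_le hnk)]
    refine Finset.sum_congr rfl fun t ht => ?_
    have e1 := card_lt_modEq_of_balanced (pow_pos hp.pos t)
      (hbal t (Finset.mem_Ico.mp ht).2.le)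
    have e2 := card_lt_modEq_of_balanced (pow_pos hp.pos t) (hval t)
    rw [← e2] at e1
    exact_mod_cast mul_left_cancel₀ two_ne_zero e1
  have hmul := det_vandermonde_eq_prod_factorial_mul_det_choose w
  rw [← det_vandermonde_val_eq_prod_factorial] at hmul
  have hw0 : (Matrix.vandermonde fun i => (w i : ℤ)).det ≠ 0 :=
    Matrix.det_vandermonde_ne_zero_iff.mpr fun i j h => hw (by exact_mod_cast h)
  rw [hmul] at hw0
  intro hdvd
  rw [hmul, Int.natAbs_mul, Nat.factorization_mul (by simpa using left_ne_zero_of_mul hw0)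
    (by simpa using right_ne_zero_of_mul hw0)] at hfac
  have hpos := hp.factorization_pos_of_dvd (Int.natAbs_ne_zero.mpr (right_ne_zero_of_mul hw0))
    (Int.natCast_dvd.mp hdvd)
  simp only [Finsupp.add_apply] at hfac
  omega

/-! ### Sparse polynomials vanishing at roots of unity -/

section

open Polynomial

/-- A valuation ring of a field of characteristic zero lying over the prime `p`. -/
theorem exists_valuationSubring_natCast_mem_nonunits (K : Type*) [Field K] [CharZero K] {p : ℕ}
    (hp : p.Prime) : ∃ V : ValuationSubring K, (p : K) ∈ V.nonunits := by
  let A : Subring K := (Int.castRingHom K).range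
  let P : A := ⟨p, p, by simp⟩
  have hI : Ideal.span {P} ≠ ⊤ := by
    rw [Ne, Ideal.span_singleton_eq_top]
    intro h
    obtain ⟨⟨_, z, rfl⟩, hb⟩ := isUnit_iff_exists_inv.mp h
    have h1 : ((p : ℤ) * z : ℤ) = 1 := by
      have h2 : (p : K) * (z : K) = 1 := by simpa [P] using congrArg (fun y : A => (y : K)) hb
      exact_mod_cast h2
    exact (Nat.prime_iff_prime_int.mp hp).not_isUnit (IsUnit.of_mul_eq_one _ h1)
  obtain ⟨V, -, hV⟩ := Ideal.image_subset_nonunits_valuationSubring _ hI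
  exact ⟨V, hV ⟨P, Ideal.subset_span rfl, rfl⟩⟩

/-- Over a field of characteristic `p`, a polynomial with `n` monomials whose exponents have an
invertible binomial determinant modulo `p` cannot vanish at `1` to order `n`. -/
theorem eq_zero_of_X_sub_one_pow_dvd {k : Type*} [Field k] {p n : ℕ} [CharP k p] {w : Fin n → ℕ}
    (hdet : ¬ (p : ℤ) ∣ (Matrix.of fun i j : Fin n => ((w i).choose j : ℤ)).det) {u : Fin n → k}
    (h : (X - 1 : k[X]) ^ n ∣ ∑ i, C (u i) * X ^ w i) : u = 0 := by
  let B : Matrix (Fin n) (Fin n) k := Matrix.of fun i j => ((w i).choose j : k)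
  have hB : B.det ≠ 0 := by
    have : B = (Int.castRingHom k).mapMatrix
        (Matrix.of fun i j : Fin n => ((w i).choose j : ℤ)) := by
      ext i j; simp [B]
    rw [this, ← RingHom.map_det, eq_intCast]
    exact fun h0 => hdet ((CharP.intCast_eq_zero_iff k p _).mp h0)
  refine Matrix.eq_zero_of_vecMul_eq_zero hB ?_
  ext j
  have h1 : (X : k[X]) ^ n ∣ taylor 1 (∑ i, C (u i) * X ^ w i) := by
    have := map_dvd (taylorAlgHom (1 : k)) h
    simpa using this
  have h2 := X_pow_dvd_iff.mp h1 j j.2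
  rw [taylor_coeff] at h2
  simp only [C_mul_X_pow_eq_monomial, map_sum, hasseDeriv_monomial, eval_finsetSum, eval_monomial,
    one_pow, mul_one] at h2
  rw [Pi.zero_apply, ← h2]
  change ∑ i, u i * ((w i).choose j : k) = _
  exact Finset.sum_congr rfl fun i _ => mul_comm (u i) _

/-- A polynomial over a field of characteristic zero with `n` monomials that has `n` distinct
roots among the `p ^ k`-th roots of unity vanishes, provided its exponents have an invertible
binomial determinant modulo `p`. -/
theorem eq_zero_of_eval_rootsOfUnity_eq_zero {K : Type*} [Field K] [CharZero K] {p k n : ℕ}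
    (hp : p.Prime) {w : Fin n → ℕ}
    (hdet : ¬ (p : ℤ) ∣ (Matrix.of fun i j : Fin n => ((w i).choose j : ℤ)).det)
    {x : Fin n → K} (hx : Function.Injective x) (hx1 : ∀ l, x l ^ p ^ k = 1) {u : Fin n → K}
    (h : ∀ l, ∑ i, u i * x l ^ w i = 0) : u = 0 := by
  obtain ⟨V, hV⟩ := exists_valuationSubring_natCast_mem_nonunits K hp
  by_contra hu
  obtain ⟨i₁, hi₁⟩ := Function.ne_iff.mp hu
  -- Scale by a coefficient of maximal valuation: all coefficients become integral, one becomes 1.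
  obtain ⟨i₀, -, hi₀⟩ := Finset.exists_max_image Finset.univ (fun i => V.valuation (u i))
    ⟨i₁, Finset.mem_univ _⟩
  have hu₀ : u i₀ ≠ 0 := by
    intro h0
    have := hi₀ i₁ (Finset.mem_univ _)
    rw [h0, map_zero, le_zero_iff, map_eq_zero] at this
    exact hi₁ this
  have hint : ∀ i, u i / u i₀ ∈ V := by
    intro i
    rw [← V.valuation_le_one_iff, map_div₀]
    exact div_le_one_of_le₀ (hi₀ i (Finset.mem_univ _)) zero_le
  have hxV : ∀ l, x l ∈ V := by
    intro l
    rw [← V.valuation_le_one_iff]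
    have := congrArg V.valuation (hx1 l)
    rw [map_pow, map_one, pow_eq_one_iff_of_nonneg zero_le (pow_pos hp.pos k).ne'] at this
    exact this.le
  let u' : Fin n → V := fun i => ⟨u i / u i₀, hint i⟩
  let x' : Fin n → V := fun l => ⟨x l, hxV l⟩
  let f : V[X] := ∑ i, C (u' i) * X ^ w i
  have hroot : ∀ l, f.eval (x' l) = 0 := by
    intro l
    apply Subtype.ext
    have : ((f.eval (x' l) : V) : K) = (∑ i, u i * x l ^ w i) / u i₀ := by
      simp only [f, eval_finsetSum, eval_mul, eval_C, eval_pow, eval_X, Finset.sum_div]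
      push_cast
      refine Finset.sum_congr rfl fun i _ => ?_
      simp only [u', x']
      ring
    rw [this, h l]
    simp
  have hdvd : ∏ l, (X - C (x' l)) ∣ f := by
    rcases eq_or_ne f 0 with hf | hf
    · simp [hf]
    have hnodup : (Finset.univ.val.map x').Nodup :=
      Finset.univ.nodup.map fun a b hab => hx (congrArg Subtype.val hab)
    have := (Multiset.prod_X_sub_C_dvd_iff_le_roots hf (Finset.univ.val.map x')).mpr
      ((Multiset.le_iff_subset hnodup).mpr fun y hy => by
        obtain ⟨l, -, rfl⟩ := Multiset.mem_map.mp hy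
        exact (mem_roots hf).mpr (hroot l))
    rw [Multiset.map_map] at this
    exact this
  let κ := IsLocalRing.ResidueField V
  have hpκ : (p : κ) = 0 := by
    have h0 : IsLocalRing.residue V (p : V) = 0 := by
      rw [IsLocalRing.residue_eq_zero_iff, ← V.coe_mem_nonunits_iff]
      exact_mod_cast hV
    simpa using h0
  have : CharP κ p := (CharP.charP_iff_prime_eq_zero hp).mpr hpκ
  have : Fact p.Prime := ⟨hp⟩
  have hres : ∀ l, IsLocalRing.residue V (x' l) = 1 := by
    intro l
    have h1 : (IsLocalRing.residue V (x' l) - 1) ^ p ^ k = 0 := by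
      have h2 : x' l ^ p ^ k = 1 := Subtype.ext (by simpa [x'] using hx1 l)
      rw [sub_pow_char_pow, ← map_pow, h2]
      simp
    exact sub_eq_zero.mp (pow_eq_zero_iff (pow_pos hp.pos k).ne' |>.mp h1)
  have hmap := map_dvd (mapRingHom (IsLocalRing.residue V)) hdvd
  have hzero : (fun i => IsLocalRing.residue V (u' i)) = 0 := by
    refine eq_zero_of_X_sub_one_pow_dvd hdet ?_
    simpa [Polynomial.map_prod, Polynomial.map_sum, hres, f] using hmap
  have h1 : u' i₀ = 1 := Subtype.ext (by simp [u', hu₀])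
  have := congrFun hzero i₀
  simp [h1] at this

end

/-! ### Universal sampling sets -/

/-- A set `Ω ⊆ ℤ_d` is a universal sampling set for `L` frequencies if any `L` distinct characters
are linearly independent on `Ω`. -/
def IsUniversalSampling {d : ℕ} [NeZero d] (L : ℕ) (Ω : Finset (ZMod d)) : Prop :=
  ∀ s : Fin L → ZMod d, Function.Injective s → ∀ v : Fin L → ℂ,
    (∀ i ∈ Ω, ∑ l, v l * ZMod.stdAddChar (s l * i) = 0) → v = 0

section

variable {d L : ℕ} [NeZero d] {Ω : Finset (ZMod d)}

/-- When `Ω` has exactly `L` elements, the matrices in question are square, so that independence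
of the columns can be replaced by independence of the rows. -/
theorem isUniversalSampling_iff_rows (hΩ : Ω.card = L) :
    IsUniversalSampling L Ω ↔ ∀ s : Fin L → ZMod d, Function.Injective s → ∀ u : ZMod d → ℂ,
      (∀ l, ∑ i ∈ Ω, u i * ZMod.stdAddChar (s l * i) = 0) → ∀ i ∈ Ω, u i = 0 := by
  let e := Ω.equivFinOfCardEq hΩ
  refine forall₂_congr fun s _ => ?_
  let M : Matrix (Fin L) (Fin L) ℂ := Matrix.of fun j l =>
    ZMod.stdAddChar (s l * (e.symm j : ZMod d))
  have hcol : (∀ v : Fin L → ℂ, (∀ i ∈ Ω, ∑ l, v l * ZMod.stdAddChar (s l * i) = 0) → v = 0) ↔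
      M.det ≠ 0 := by
    rw [Ne, ← Matrix.exists_mulVec_eq_zero_iff]
    push Not
    refine forall_congr' fun v => ?_
    have : M.mulVec v = 0 ↔ ∀ i ∈ Ω, ∑ l, v l * ZMod.stdAddChar (s l * i) = 0 := by
      constructor
      · intro h i hi
        simpa [M, Matrix.mulVec, dotProduct, mul_comm] using congrFun h (e ⟨i, hi⟩)
      · intro h
        ext j
        simpa [M, Matrix.mulVec, dotProduct, mul_comm] using h (e.symm j) (e.symm j).2
    rw [← this]
    tauto
  have hrow : (∀ u : ZMod d → ℂ, (∀ l, ∑ i ∈ Ω, u i * ZMod.stdAddChar (s l * i) = 0) →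
      ∀ i ∈ Ω, u i = 0) ↔ M.det ≠ 0 := by
    have hsum : ∀ (u : ZMod d → ℂ) l, Matrix.vecMul (fun j => u (e.symm j)) M l =
        ∑ i ∈ Ω, u i * ZMod.stdAddChar (s l * i) := by
      intro u l
      rw [← Finset.sum_coe_sort]
      exact Equiv.sum_comp e.symm fun i : Ω => u i * (ZMod.stdAddChar (s l * (i : ZMod d)) : ℂ)
    constructor
    · intro h hdet
      obtain ⟨v, hv0, hv⟩ := Matrix.exists_vecMul_eq_zero_iff.mpr hdet
      classical
      let u : ZMod d → ℂ := fun i => if hi : i ∈ Ω then v (e ⟨i, hi⟩) else 0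
      have hu : (fun j => u (e.symm j)) = v := by
        ext j
        simp [u]
      have h0 := h u fun l => by rw [← hsum, hu, hv, Pi.zero_apply]
      exact hv0 (hu ▸ funext fun j => h0 _ (e.symm j).2)
    · intro hdet u hu i hi
      have := Matrix.eq_zero_of_vecMul_eq_zero hdet
        (v := fun j => u (e.symm j)) (funext fun l => (hsum u l).trans (hu l))
      simpa using congrFun this (e ⟨i, hi⟩)
  rw [hcol, hrow]

end

/-! ### Frequencies filling residue classes -/

/-- An enumeration of `ℤ_(m n)` by the indices `l < m n` in which consecutive blocks of `m` indices
run through the residue classes modulo `n` one after the other. -/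
def blockFrequency (m n l : ℕ) : ZMod (m * n) := ((l / m + n * (l % m) : ℕ) : ZMod (m * n))

theorem blockFrequency_injOn {m n : ℕ} (hm : 0 < m) :
    Set.InjOn (blockFrequency m n) (Set.Iio (m * n)) := by
  have hlt : ∀ l < m * n, l / m < n ∧ l / m + n * (l % m) < m * n := by
    intro l hl
    have h1 : l / m < n := Nat.div_lt_of_lt_mul hl
    have h2 := Nat.mod_lt l hm
    refine ⟨h1, ?_⟩
    nlinarith
  intro a ha b hb hab
  obtain ⟨ha1, ha2⟩ := hlt a ha
  obtain ⟨hb1, hb2⟩ := hlt b hb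
  have h : a / m + n * (a % m) = b / m + n * (b % m) := by
    have := (ZMod.natCast_eq_natCast_iff' _ _ _).mp hab
    rwa [Nat.mod_eq_of_lt ha2, Nat.mod_eq_of_lt hb2] at this
  have hn : 0 < n := (Nat.zero_le _).trans_lt ha1
  have hdiv : a / m = b / m := by
    have := congrArg (· % n) h
    simpa [Nat.add_mul_mod_self_left, Nat.mod_eq_of_lt ha1, Nat.mod_eq_of_lt hb1] using this
  have hmod : a % m = b % m := by
    rw [hdiv] at h
    exact Nat.eq_of_mul_eq_mul_left hn (Nat.add_left_cancel h)
  rw [← Nat.div_add_mod a m, ← Nat.div_add_mod b m, hdiv, hmod]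

/-- The multiples of `m` in `ℤ_(m n)` are the elements killed by `n`. -/
theorem mem_zmultiples_iff_natCast_mul_eq_zero {m n : ℕ} [NeZero (m * n)] (j : ZMod (m * n)) :
    j ∈ AddSubgroup.zmultiples (m : ZMod (m * n)) ↔ (n : ZMod (m * n)) * j = 0 := by
  have hn : 0 < n := Nat.pos_of_ne_zero (right_ne_zero_of_mul (NeZero.ne (m * n)))
  constructor
  · rintro ⟨z, rfl⟩
    have : (n : ZMod (m * n)) * m = 0 := by
      rw [mul_comm, ← Nat.cast_mul, ZMod.natCast_self]
    simp only [zsmul_eq_mul]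
    rw [mul_left_comm, this, mul_zero]
  · intro h
    have h1 : ((n * j.val : ℕ) : ZMod (m * n)) = 0 := by simpa using h
    rw [ZMod.natCast_eq_zero_iff, mul_comm n] at h1
    obtain ⟨t, ht⟩ := Nat.dvd_of_mul_dvd_mul_right hn h1
    refine ⟨t, ?_⟩
    rw [← ZMod.natCast_zmod_val j, ht]
    simp [mul_comm]

theorem stdAddChar_blockFrequency_mul {m n l : ℕ} [NeZero (m * n)] (j : ZMod (m * n)) :
    (ZMod.stdAddChar (blockFrequency m n l * j) : ℂ) =
      ZMod.stdAddChar (((l / m : ℕ) : ZMod (m * n)) * j) *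
        ZMod.stdAddChar ((n : ZMod (m * n)) * j) ^ (l % m) := by
  rw [← AddChar.map_nsmul_eq_pow, ← AddChar.map_add_eq_mul]
  congr 1
  simp only [blockFrequency, nsmul_eq_mul]
  push_cast
  ring

theorem sum_range_stdAddChar_pow {m n : ℕ} [NeZero (m * n)] {j : ZMod (m * n)}
    (hj : j ∉ AddSubgroup.zmultiples (m : ZMod (m * n))) :
    ∑ t ∈ Finset.range m, (ZMod.stdAddChar ((n : ZMod (m * n)) * j) : ℂ) ^ t = 0 := by
  have h1 : (ZMod.stdAddChar ((n : ZMod (m * n)) * j) : ℂ) ≠ 1 := by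
    intro h
    rw [mem_zmultiples_iff_natCast_mul_eq_zero] at hj
    exact hj (ZMod.injective_stdAddChar (h.trans (AddChar.map_zero_eq_one _).symm))
  have h2 : (ZMod.stdAddChar ((n : ZMod (m * n)) * j) : ℂ) ^ m = 1 := by
    rw [← AddChar.map_nsmul_eq_pow, nsmul_eq_mul, ← mul_assoc, ← Nat.cast_mul,
      ZMod.natCast_self, zero_mul, AddChar.map_zero_eq_one]
  rw [geom_sum_eq h1, h2, sub_self, zero_div]

theorem sum_range_mul_eq_sum_sum {M : Type*} [AddCommMonoid M] (f : ℕ → M) (m q : ℕ) :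
    ∑ l ∈ Finset.range (m * q), f l =
      ∑ r ∈ Finset.range q, ∑ t ∈ Finset.range m, f (m * r + t) := by
  induction q with
  | zero => simp
  | succ q ih => rw [mul_add_one, Finset.sum_range_add, ih, Finset.sum_range_succ]

/-- A homogeneous linear system with more unknowns than equations has a nonzero solution. -/
theorem exists_ne_zero_sum_mul_eq_zero {ι κ : Type*} [Fintype ι] [Fintype κ]
    (h : Fintype.card κ < Fintype.card ι) (B : κ → ι → ℂ) :
    ∃ u : ι → ℂ, u ≠ 0 ∧ ∀ r, ∑ i, u i * B r i = 0 := by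
  obtain ⟨u, hu, hu0⟩ := Submodule.ne_bot_iff _ |>.mp
    (LinearMap.ker_ne_bot_of_finrank_lt (f := Matrix.mulVecLin (Matrix.of B)) (by simpa using h))
  refine ⟨u, hu0, fun r => ?_⟩
  have := congrFun (LinearMap.mem_ker.mp hu) r
  simpa [Matrix.mulVec, dotProduct, mul_comm] using this

/-- A universal sampling set has no coset with too many elements: the first `L` block frequencies
involve only `⌈L/m⌉` residue classes, hence at most that many distinct characters up to scalars on
a coset. -/
theorem IsUniversalSampling.card_coset_le {m n : ℕ} [NeZero (m * n)] {Ω : Finset (ZMod (m * n))}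
    (h : IsUniversalSampling Ω.card Ω) (c : ZMod (m * n)) {T : Finset (ZMod (m * n))}
    (hTΩ : T ⊆ Ω) (hT : ∀ i ∈ T, i - c ∈ AddSubgroup.zmultiples (m : ZMod (m * n))) :
    T.card ≤ (Ω.card + m - 1) / m := by
  have hm : 0 < m := Nat.pos_of_ne_zero (left_ne_zero_of_mul (NeZero.ne (m * n)))
  by_contra! hlt
  obtain ⟨u, hu0, hu⟩ := exists_ne_zero_sum_mul_eq_zero (ι := T) (κ := Fin ((Ω.card + m - 1) / m))
    (by simpa using hlt) fun r i =>
      ZMod.stdAddChar (((r : ℕ) : ZMod (m * n)) * ((i : ZMod (m * n)) - c))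
  have hL : Ω.card ≤ m * n := by simpa [ZMod.card] using Ω.card_le_univ
  classical
  have := (isUniversalSampling_iff_rows rfl).mp h (fun l => blockFrequency m n l)
    (fun a b hab => Fin.ext (blockFrequency_injOn hm (a.2.trans_le hL) (b.2.trans_le hL) hab))
    (fun i => if hi : i ∈ T then u ⟨i, hi⟩ else 0) (fun l => ?_)
  · refine hu0 (funext fun i => ?_)
    simpa using this i (hTΩ i.2)
  · have hr : (l : ℕ) / m < (Ω.card + m - 1) / m := by
      rw [Nat.div_lt_iff_lt_mul hm]
      have h1 : Ω.card ≤ (Ω.card + m - 1) / m * m := by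
        have := Nat.div_add_mod (Ω.card + m - 1) m
        have := Nat.mod_lt (Ω.card + m - 1) hm
        rw [mul_comm] at *
        omega
      exact l.2.trans_le h1
    rw [← Finset.sum_subset hTΩ (fun i _ hi => by simp [hi]), ← Finset.sum_coe_sort]
    have h1 := congrArg (ZMod.stdAddChar (blockFrequency m n l * c) * ·) (hu ⟨_, hr⟩)
    simp only [mul_zero, Finset.mul_sum] at h1
    refine (Finset.sum_congr rfl fun i _ => ?_).trans h1
    have h2 : (ZMod.stdAddChar (blockFrequency m n l * (i : ZMod (m * n))) : ℂ) =
        ZMod.stdAddChar (blockFrequency m n l * c) *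
          ZMod.stdAddChar (blockFrequency m n l * ((i : ZMod (m * n)) - c)) := by
      rw [← AddChar.map_add_eq_mul]; ring_nf
    rw [h2, stdAddChar_blockFrequency_mul ((i : ZMod (m * n)) - c),
      (mem_zmultiples_iff_natCast_mul_eq_zero _).mp (hT i i.2),
      AddChar.map_zero_eq_one, one_pow, mul_one]
    simp only [Finset.coe_mem, dite_true]
    ring

/-- A universal sampling set has no coset with too few elements: the first `L` block frequencies
contain `⌊L/m⌋` full residue classes, and summing the characters of one class gives a function
supported on a coset. -/
theorem IsUniversalSampling.le_card_coset {m n : ℕ} [NeZero (m * n)] {Ω : Finset (ZMod (m * n))}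
    (h : IsUniversalSampling Ω.card Ω) (c : ZMod (m * n)) {T : Finset (ZMod (m * n))}
    (hT : ∀ i ∈ Ω, i - c ∈ AddSubgroup.zmultiples (m : ZMod (m * n)) → i ∈ T) :
    Ω.card / m ≤ T.card := by
  have hm : 0 < m := Nat.pos_of_ne_zero (left_ne_zero_of_mul (NeZero.ne (m * n)))
  have hL : Ω.card ≤ m * n := by simpa [ZMod.card] using Ω.card_le_univ
  by_contra! hlt
  obtain ⟨v, hv0, hv⟩ := exists_ne_zero_sum_mul_eq_zero (κ := T) (ι := Fin (Ω.card / m))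
    (by simpa using hlt) fun i r =>
      ZMod.stdAddChar (((r : ℕ) : ZMod (m * n)) * ((i : ZMod (m * n)) - c))
  obtain ⟨r₀, hr₀⟩ := Function.ne_iff.mp hv0
  let v' : ℕ → ℂ := fun r => if hr : r < Ω.card / m then v ⟨r, hr⟩ else 0
  have hfun := h (fun l => blockFrequency m n l)
    (fun a b hab => Fin.ext (blockFrequency_injOn hm (a.2.trans_le hL) (b.2.trans_le hL) hab))
    (fun l => v' (l / m) * ZMod.stdAddChar (-(blockFrequency m n l * c))) (fun i hi => ?_)
  · have hlt' : m * (r₀ : ℕ) < Ω.card :=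
      (Nat.mul_lt_mul_of_pos_left r₀.2 hm).trans_le (Nat.mul_div_le _ _)
    have := congrFun hfun ⟨m * r₀, hlt'⟩
    simp only [Nat.mul_div_cancel_left _ hm, v', r₀.2, dite_true, Fin.eta, Pi.zero_apply] at this
    exact hr₀ ((mul_eq_zero.mp this).resolve_right (AddChar.val_isUnit _ _).ne_zero)
  · let F : ℕ → ℂ := fun l => v' (l / m) * ZMod.stdAddChar (blockFrequency m n l * (i - c))
    have h1 : ∀ l : Fin Ω.card, v' (l / m) * ZMod.stdAddChar (-(blockFrequency m n l * c)) *
        ZMod.stdAddChar (blockFrequency m n l * i) = F l := by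
      intro l
      rw [mul_assoc, ← AddChar.map_add_eq_mul]
      simp only [F]
      ring_nf
    -- The coefficients vanish beyond the last full residue class.
    have h2 : ∑ l ∈ Finset.range Ω.card, F l = ∑ l ∈ Finset.range (m * (Ω.card / m)), F l := by
      refine (Finset.sum_subset (by simpa using Nat.mul_div_le _ _) fun l _ hl => ?_).symm
      have : ¬ l / m < Ω.card / m := by
        rw [Nat.div_lt_iff_lt_mul hm, mul_comm]
        simpa using hl
      simp [F, v', this]
    have h3 : ∑ l ∈ Finset.range (m * (Ω.card / m)), F l =
        ∑ r ∈ Finset.range (Ω.card / m), v' r *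
          ZMod.stdAddChar ((r : ZMod (m * n)) * (i - c)) *
          ∑ t ∈ Finset.range m, ZMod.stdAddChar ((n : ZMod (m * n)) * (i - c)) ^ t := by
      rw [sum_range_mul_eq_sum_sum]
      refine Finset.sum_congr rfl fun r _ => ?_
      rw [Finset.mul_sum]
      refine Finset.sum_congr rfl fun t ht => ?_
      have ht' := Finset.mem_range.mp ht
      have hdiv : (m * r + t) / m = r := by
        rw [Nat.mul_add_div hm, Nat.div_eq_of_lt ht', add_zero]
      simp only [F]
      rw [stdAddChar_blockFrequency_mul, hdiv, Nat.mul_add_mod, Nat.mod_eq_of_lt ht', mul_assoc]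
    rw [Finset.sum_congr rfl fun l _ => h1 l, Fin.sum_univ_eq_sum_range, h2, h3, ← Finset.sum_mul]
    by_cases hmem : i - c ∈ AddSubgroup.zmultiples (m : ZMod (m * n))
    · have := hv ⟨i, hT i hi hmem⟩
      rw [Finset.sum_range]
      simp only [v', Fin.is_lt, dite_true, Fin.eta]
      rw [this, zero_mul]
    · rw [sum_range_stdAddChar_pow hmem, mul_zero]

/-! ### Frames and diagonal operators -/

/-- In finite dimension a finite family is a frame as soon as its analysis operator is injective. -/
theorem isFiniteFrame_iff {ι E : Type*} [Fintype ι] [NormedAddCommGroup E] [InnerProductSpace ℂ E]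
    [FiniteDimensional ℂ E] (g : ι → E) :
    IsFiniteFrame g ↔ ∀ f : E, (∀ j, inner ℂ (g j) f = 0) → f = 0 := by
  constructor
  · rintro ⟨a, b, ha, -, h⟩ f hf
    have h1 := (h f).1
    simp only [hf, norm_zero, ne_eq, OfNat.ofNat_ne_zero, not_false_eq_true, zero_pow,
      Finset.sum_const_zero] at h1
    have h2 : ‖f‖ ^ 2 ≤ 0 := by
      by_contra h3
      exact (mul_pos ha (not_le.mp h3)).not_ge h1
    simpa using h2.antisymm (sq_nonneg _)
  · intro h
    let T : E →ₗ[ℂ] EuclideanSpace ℂ ι :=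
      (WithLp.linearEquiv 2 ℂ (ι → ℂ)).symm.toLinearMap ∘ₗ
        LinearMap.pi fun j => (innerSL ℂ (g j)).toLinearMap
    have hT : ∀ f, ‖T f‖ ^ 2 = ∑ j, ‖inner ℂ (g j) f‖ ^ 2 := fun f => by
      rw [EuclideanSpace.norm_sq_eq]
      rfl
    have hker : LinearMap.ker T = ⊥ := by
      rw [LinearMap.ker_eq_bot']
      intro f hf
      exact h f fun j => congrArg (fun v : EuclideanSpace ℂ ι => v j) hf
    obtain ⟨K, hK, hanti⟩ := T.exists_antilipschitzWith hker
    refine ⟨((K : ℝ) ^ 2)⁻¹, ‖LinearMap.toContinuousLinearMap T‖ ^ 2 + 1, by positivity,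
      by positivity, fun f => ?_⟩
    rw [← hT]
    constructor
    · have h1 : ‖f‖ ≤ K * ‖T f‖ := by simpa using hanti.le_mul_dist f 0
      rw [inv_mul_le_iff₀ (by positivity), ← mul_pow]
      gcongr
    · have h1 : ‖T f‖ ≤ ‖LinearMap.toContinuousLinearMap T‖ * ‖f‖ :=
        (LinearMap.toContinuousLinearMap T).le_opNorm f
      have h2 := pow_le_pow_left₀ (norm_nonneg _) h1 2
      rw [mul_pow] at h2
      nlinarith [sq_nonneg ‖f‖]

/-- The eigenspaces of an operator that is diagonal in a basis are spanned by basis vectors. -/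
theorem eigenspace_eq_span_of_diagonal {ι V : Type*} [Fintype ι] [AddCommGroup V] [Module ℂ V]
    (b : Module.Basis ι ℂ V) {A : Module.End ℂ V} {ev : ι → ℂ} (hA : ∀ i, A (b i) = ev i • b i)
    (μ : ℂ) : A.eigenspace μ = Submodule.span ℂ (b '' {i | ev i = μ}) := by
  apply le_antisymm
  · intro v hv
    rw [Module.End.mem_eigenspace_iff] at hv
    rw [Module.Basis.mem_span_image]
    intro i hi
    have h1 : ∀ v, b.repr (A v) i = ev i * b.repr v i := by
      intro v
      have : (b.coord i) ∘ₗ A = ev i • b.coord i := by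
        refine b.ext fun j => ?_
        rcases eq_or_ne j i with rfl | hji
        · simp [hA]
        · simp [hA, hji]
      simpa using LinearMap.congr_fun this v
    have h2 := h1 v
    rw [hv, map_smul, Finsupp.smul_apply, smul_eq_mul] at h2
    exact (mul_right_cancel₀ (Finsupp.mem_support_iff.mp hi) h2).symm
  · rw [Submodule.span_le]
    rintro _ ⟨i, hi, rfl⟩
    rw [SetLike.mem_coe, Module.End.mem_eigenspace_iff, hA, hi]

theorem finrank_eigenspace_of_diagonal {ι V : Type*} [Fintype ι] [AddCommGroup V] [Module ℂ V]
    (b : Module.Basis ι ℂ V) {A : Module.End ℂ V} {ev : ι → ℂ} (hA : ∀ i, A (b i) = ev i • b i)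
    (μ : ℂ) : Module.finrank ℂ (A.eigenspace μ) = (Finset.univ.filter fun i => ev i = μ).card := by
  classical
  rw [eigenspace_eq_span_of_diagonal b hA, Set.image_eq_range]
  rw [show (fun x : {i | ev i = μ} => b x) = b ∘ Subtype.val from rfl,
    finrank_span_eq_card (b.linearIndependent.comp _ Subtype.val_injective)]
  exact Fintype.card_subtype _

theorem hasEigenvalue_iff_of_diagonal {ι V : Type*} [Fintype ι] [AddCommGroup V] [Module ℂ V]
    (b : Module.Basis ι ℂ V) {A : Module.End ℂ V} {ev : ι → ℂ} (hA : ∀ i, A (b i) = ev i • b i)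
    (μ : ℂ) : A.HasEigenvalue μ ↔ μ ∈ Finset.univ.image ev := by
  rw [Module.End.hasEigenvalue_iff, eigenspace_eq_span_of_diagonal b hA, Ne, Submodule.span_eq_bot]
  constructor
  · intro h
    by_contra hμ
    refine h ?_
    rintro _ ⟨i, hi, rfl⟩
    exact absurd (Finset.mem_image.mpr ⟨i, Finset.mem_univ _, hi⟩) hμ
  · intro h h'
    obtain ⟨i, -, hi⟩ := Finset.mem_image.mp h
    exact b.ne_zero i (h' _ ⟨i, hi, rfl⟩)

theorem numEigenvalues_of_diagonal {ι V : Type*} [Fintype ι] [AddCommGroup V] [Module ℂ V]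
    (b : Module.Basis ι ℂ V) {A : Module.End ℂ V} {ev : ι → ℂ} (hA : ∀ i, A (b i) = ev i • b i) :
    numEigenvalues A = (Finset.univ.image ev).card := by
  rw [numEigenvalues, ← Set.ncard_coe_finset]
  congr 1
  ext μ
  exact hasEigenvalue_iff_of_diagonal b hA μ

theorem maxGeomMultiplicity_of_diagonal {ι V : Type*} [Fintype ι] [Nonempty ι] [AddCommGroup V]
    [Module ℂ V] (b : Module.Basis ι ℂ V) {A : Module.End ℂ V} {ev : ι → ℂ}
    (hA : ∀ i, A (b i) = ev i • b i) :
    IsGreatest (Set.range fun i => (Finset.univ.filter fun j => ev j = ev i).card)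
      (maxGeomMultiplicity A) := by
  have h : (fun μ : ℂ => Module.finrank ℂ (A.eigenspace μ)) '' {μ : ℂ | A.HasEigenvalue μ} =
      Set.range fun i => (Finset.univ.filter fun j => ev j = ev i).card := by
    ext m
    simp only [Set.mem_image, Set.mem_ofPred_eq, hasEigenvalue_iff_of_diagonal b hA,
      finrank_eigenspace_of_diagonal b hA, Finset.mem_image, Finset.mem_univ, true_and,
      Set.mem_range]
    constructor
    · rintro ⟨_, ⟨i, rfl⟩, rfl⟩
      exact ⟨i, rfl⟩
    · rintro ⟨i, rfl⟩
      exact ⟨_, ⟨i, rfl⟩, rfl⟩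
  rw [maxGeomMultiplicity, h]
  have hfin := Set.finite_range fun i => (Finset.univ.filter fun j => ev j = ev i).card
  exact ⟨Nat.sSup_mem (Set.range_nonempty _) hfin.bddAbove,
    fun _ hx => le_csSup hfin.bddAbove hx⟩

/-- If the first moments of `c` against `ev`, as many as there are distinct values of `ev`, vanish,
then `c` sums to zero over each level set of `ev`: the indicator function of one value is a
polynomial of degree less than the number of values. -/
theorem sum_fiber_eq_zero_of_sum_pow_mul_eq_zero {ι : Type*} [Fintype ι] {ev c : ι → ℂ}
    (h : ∀ n < (Finset.univ.image ev).card, ∑ i, ev i ^ n * c i = 0) (μ : ℂ) :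
    ∑ i with ev i = μ, c i = 0 := by
  classical
  let s := Finset.univ.image ev
  let P := Lagrange.interpolate s id fun z => if z = μ then (1 : ℂ) else 0
  have hP : ∑ i, P.eval (ev i) * c i = 0 := by
    have hdeg : P.degree < s.card := Lagrange.degree_interpolate_lt _ (Set.injOn_id _)
    simp_rw [Polynomial.eval_eq_sum, Polynomial.sum, Finset.sum_mul]
    rw [Finset.sum_comm]
    refine Finset.sum_eq_zero fun n hn => ?_
    have hn' : n < s.card := by
      exact_mod_cast (Polynomial.le_degree_of_mem_supp n hn).trans_lt hdeg
    rw [← mul_zero (P.coeff n), ← h n hn', Finset.mul_sum]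
    exact Finset.sum_congr rfl fun i _ => mul_assoc _ _ _
  rw [Finset.sum_filter]
  refine (Finset.sum_congr rfl fun i _ => ?_).trans hP
  have := Lagrange.eval_interpolate_at_node (s := s) (v := id)
    (fun z => if z = μ then (1 : ℂ) else 0) (Set.injOn_id _)
    (Finset.mem_image_of_mem ev (Finset.mem_univ i))
  simp only [id] at this
  rw [show P.eval (ev i) = if ev i = μ then 1 else 0 from this, ite_mul, one_mul,
    zero_mul]

/-! ### Circular convolution in the Fourier basis -/

section

variable {d : ℕ} [NeZero d]

/-- The basis of `ℓ²(ℤ_d)` consisting of the characters, each divided by `d`. -/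
noncomputable def characterBasis (d : ℕ) [NeZero d] :
    Module.Basis (ZMod d) ℂ (EuclideanSpace ℂ (ZMod d)) :=
  Module.Basis.ofEquivFun ((WithLp.linearEquiv 2 ℂ (ZMod d → ℂ)).trans ZMod.dft)

theorem characterBasis_apply (ξ k : ZMod d) :
    characterBasis d ξ k = (d : ℂ)⁻¹ * ZMod.stdAddChar (ξ * k) := by
  have : characterBasis d ξ = WithLp.toLp 2 (𝓕⁻ (Pi.single ξ (1 : ℂ))) := by
    simp [characterBasis]
  rw [this]
  simp [ZMod.invDFT_apply, Pi.single_apply]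

theorem circularConvolution_characterBasis (a : ZMod d → ℂ) (ξ : ZMod d) :
    circularConvolution a (characterBasis d ξ) = 𝓕 a ξ • characterBasis d ξ := by
  ext k
  change ∑ i, a i * characterBasis d ξ (k - i) = 𝓕 a ξ * characterBasis d ξ k
  simp only [characterBasis_apply, ZMod.dft_apply, Finset.sum_mul, smul_eq_mul]
  refine Finset.sum_congr rfl fun i _ => ?_
  rw [show ξ * (k - i) = -(i * ξ) + ξ * k by ring, AddChar.map_add_eq_mul]
  ring

theorem single_eq_sum_characterBasis (i : ZMod d) :
    EuclideanSpace.single i (1 : ℂ) =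
      ∑ ξ, (ZMod.stdAddChar (-(ξ * i)) : ℂ) • characterBasis d ξ := by
  rw [← (characterBasis d).sum_repr (EuclideanSpace.single i (1 : ℂ))]
  refine Finset.sum_congr rfl fun ξ _ => ?_
  congr 1
  change 𝓕 (Pi.single i (1 : ℂ)) ξ = _
  simp [ZMod.dft_apply, Pi.single_apply, mul_comm]

/-- Here `𝓕 a` is the symbol of the convolution operator, so that this is the diagonal form of its
powers. -/
theorem pow_circularConvolution_single (a : ZMod d → ℂ) (n : ℕ) (i : ZMod d) :
    (circularConvolution a ^ n) (EuclideanSpace.single i (1 : ℂ)) =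
      ∑ ξ, (𝓕 a ξ ^ n * ZMod.stdAddChar (-(ξ * i)) : ℂ) • characterBasis d ξ := by
  have h : ∀ ξ, (circularConvolution a ^ n) (characterBasis d ξ) =
      𝓕 a ξ ^ n • characterBasis d ξ := by
    intro ξ
    induction n with
    | zero => simp
    | succ n ih =>
      rw [pow_succ, Module.End.mul_apply, circularConvolution_characterBasis, map_smul, ih,
        smul_smul, pow_succ']
  rw [single_eq_sum_characterBasis, map_sum]
  refine Finset.sum_congr rfl fun ξ _ => ?_
  rw [map_smul, h, smul_smul, mul_comm]

/-- The coefficients of a vector against the character basis are arbitrary. -/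
theorem bijective_inner_characterBasis (d : ℕ) [NeZero d] :
    Function.Bijective fun (f : EuclideanSpace ℂ (ZMod d)) ξ => inner ℂ (characterBasis d ξ) f := by
  let T : EuclideanSpace ℂ (ZMod d) →ₗ[ℂ] (ZMod d → ℂ) :=
    LinearMap.pi fun ξ => (innerSL ℂ (characterBasis d ξ)).toLinearMap
  have hinj : Function.Injective T := by
    rw [injective_iff_map_eq_zero]
    intro f hf
    rw [← inner_self_eq_zero (𝕜 := ℂ)]
    nth_rewrite 1 [← (characterBasis d).sum_repr f]
    rw [sum_inner]
    refine Finset.sum_eq_zero fun ξ _ => ?_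
    rw [inner_smul_left, show inner ℂ (characterBasis d ξ) f = 0 from congrFun hf ξ, mul_zero]
  have hdim : Module.finrank ℂ (EuclideanSpace ℂ (ZMod d)) = Module.finrank ℂ (ZMod d → ℂ) := by
    simp
  exact ⟨hinj, (LinearMap.injective_iff_surjective_of_finrank_eq_finrank hdim).mp hinj⟩

theorem inner_pow_circularConvolution_single (a : ZMod d → ℂ) (n : ℕ) (i : ZMod d)
    (f : EuclideanSpace ℂ (ZMod d)) :
    inner ℂ ((circularConvolution a ^ n) (EuclideanSpace.single i (1 : ℂ))) f =
      ∑ ξ, star (𝓕 a ξ) ^ n * (ZMod.stdAddChar (ξ * i) * inner ℂ (characterBasis d ξ) f) := by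
  rw [pow_circularConvolution_single, sum_inner]
  refine Finset.sum_congr rfl fun ξ _ => ?_
  rw [inner_smul_left, map_mul, map_pow, ← AddChar.map_neg_eq_conj, neg_neg, mul_assoc]
  rfl

/-- The dynamical sampling criterion: the iterated system is a frame if and only if, on each level
set of the symbol, the characters restricted to `Ω` are linearly independent. -/
theorem isFiniteFrame_samplingSystem_iff (a : ZMod d → ℂ) (Ω : Finset (ZMod d)) :
    IsFiniteFrame (samplingSystem (circularConvolution a) Ω) ↔
      ∀ c : ZMod d → ℂ, (∀ i ∈ Ω, ∀ μ, ∑ ξ with 𝓕 a ξ = μ, c ξ * ZMod.stdAddChar (ξ * i) = 0) →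
        c = 0 := by
  rw [isFiniteFrame_iff]
  have hN := numEigenvalues_of_diagonal _ (circularConvolution_characterBasis a)
  have key : ∀ f : EuclideanSpace ℂ (ZMod d),
      (∀ j, inner ℂ (samplingSystem (circularConvolution a) Ω j) f = 0) ↔
      ∀ i ∈ Ω, ∀ μ, ∑ ξ with 𝓕 a ξ = μ,
        inner ℂ (characterBasis d ξ) f * ZMod.stdAddChar (ξ * i) = 0 := by
    intro f
    constructor
    · intro h i hi μ
      have hcard : (Finset.univ.image fun ξ => star (𝓕 a ξ)).card =
          numEigenvalues (circularConvolution a) := by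
        rw [hN, ← Finset.card_image_of_injective (Finset.univ.image fun ξ => 𝓕 a ξ)
          (star_injective (R := ℂ)), Finset.image_image]
        rfl
      have := sum_fiber_eq_zero_of_sum_pow_mul_eq_zero (ev := fun ξ => star (𝓕 a ξ))
        (c := fun ξ => ZMod.stdAddChar (ξ * i) * inner ℂ (characterBasis d ξ) f)
        (fun n hn => by
          rw [← inner_pow_circularConvolution_single]
          exact h (⟨i, hi⟩, ⟨n, hcard ▸ hn⟩)) (star μ)
      simpa only [star_inj, mul_comm] using this
    · rintro h ⟨⟨i, hi⟩, n⟩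
      change inner ℂ ((circularConvolution a ^ (n : ℕ)) (EuclideanSpace.single i (1 : ℂ))) f = 0
      rw [inner_pow_circularConvolution_single,
        ← Finset.sum_fiberwise_of_maps_to (g := fun ξ => 𝓕 a ξ)
          (fun ξ _ => Finset.mem_image_of_mem _ (Finset.mem_univ ξ))]
      refine Finset.sum_eq_zero fun μ _ => ?_
      rw [← mul_zero (star μ ^ (n : ℕ)), ← h i hi μ, Finset.mul_sum]
      refine Finset.sum_congr rfl fun ξ hξ => ?_
      rw [(Finset.mem_filter.mp hξ).2, mul_comm (inner ℂ _ _)]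
  simp_rw [key]
  constructor
  · intro h c hc
    obtain ⟨f, rfl⟩ := (bijective_inner_characterBasis d).2 c
    rw [h f hc]
    ext ξ
    simp
  · intro h f hf
    refine (bijective_inner_characterBasis d).1 ?_
    refine (h _ hf).trans ?_
    ext ξ
    simp

end

/-! ### Universal sampling and uniform distribution -/

section

variable {d L : ℕ} [NeZero d] {Ω : Finset (ZMod d)}

theorem IsUniversalSampling.uniformlyDistributedOverDivisors (h : IsUniversalSampling Ω.card Ω) :
    UniformlyDistributedOverDivisors Ω := by
  classical
  rintro m ⟨n, rfl⟩ c
  let T := Ω.filter fun i => i - c ∈ AddSubgroup.zmultiples (m : ZMod (m * n))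
  have hT : {i : ZMod (m * n) | i ∈ Ω ∧ i - c ∈ AddSubgroup.zmultiples (m : ZMod (m * n))}.ncard =
      T.card := by
    rw [← Set.ncard_coe_finset]
    congr 1
    ext i
    simp [T]
  have hm : 0 < m := Nat.pos_of_ne_zero (left_ne_zero_of_mul (NeZero.ne (m * n)))
  have h1 := h.card_coset_le (T := T) c (Finset.filter_subset _ _)
    fun i hi => (Finset.mem_filter.mp hi).2
  have h2 := h.le_card_coset (T := T) c fun i hi hi' => Finset.mem_filter.mpr ⟨hi, hi'⟩
  have h3 : (Ω.card + m - 1) / m ≤ Ω.card / m + 1 := by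
    rw [← Nat.add_div_right _ hm]
    exact Nat.div_le_div_right (Nat.sub_le _ _)
  rw [hT, Nat.ceilDiv_eq_add_pred_div, Set.mem_insert_iff, Set.mem_singleton_iff]
  omega

theorem sub_mem_zmultiples_iff_modEq {m : ℕ} (hm : m ∣ d) (i j : ZMod d) :
    i - j ∈ AddSubgroup.zmultiples (m : ZMod d) ↔ i.val ≡ j.val [MOD m] := by
  obtain ⟨n, rfl⟩ := hm
  have hn : 0 < n := Nat.pos_of_ne_zero (right_ne_zero_of_mul (NeZero.ne (m * n)))
  rw [mem_zmultiples_iff_natCast_mul_eq_zero]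
  have h1 : (n : ZMod (m * n)) * (i - j) = (((n : ℤ) * (i.val - j.val) : ℤ) : ZMod (m * n)) := by
    simp
  rw [h1, ZMod.intCast_zmod_eq_zero_iff_dvd, Nat.ModEq.comm, Nat.modEq_iff_dvd, Nat.cast_mul,
    mul_comm (m : ℤ)]
  exact mul_dvd_mul_iff_left (by exact_mod_cast hn.ne')

/-- A dependence between the values of `L` characters on `Ω` is a polynomial with exponents in `Ω`
vanishing at `L` roots of unity. -/
theorem UniformlyDistributedOverDivisors.isUniversalSampling {p k : ℕ} (hp : p.Prime)
    (hd : d = p ^ k) (h : UniformlyDistributedOverDivisors Ω) :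
    IsUniversalSampling Ω.card Ω := by
  rw [isUniversalSampling_iff_rows rfl]
  intro s hs u hu
  let e := Ω.equivFin
  let w : Fin Ω.card → ℕ := fun j => (e.symm j : ZMod d).val
  have hw : Function.Injective w := fun a b hab =>
    e.symm.injective (Subtype.ext (ZMod.val_injective d hab))
  have hlt : ∀ j, w j < p ^ k := fun j => hd ▸ ZMod.val_lt _
  have hdet := not_dvd_det_choose_of_balanced hp hw hlt fun t ht c hc => by
    have hdvd : p ^ t ∣ d := hd ▸ pow_dvd_pow p ht
    have hcd : c < d := hc.trans_le (Nat.le_of_dvd (NeZero.pos d) hdvd)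
    have hcount : {i : ZMod d | i ∈ Ω ∧
        i - (c : ZMod d) ∈ AddSubgroup.zmultiples ((p ^ t : ℕ) : ZMod d)}.ncard =
        (Finset.univ.filter fun i => w i % p ^ t = c).card := by
      rw [← Set.ncard_coe_finset]
      symm
      refine Set.ncard_congr (fun j _ => (e.symm j : ZMod d)) ?_ ?_ ?_
      · intro j hj
        refine ⟨(e.symm j).2, ?_⟩
        rw [sub_mem_zmultiples_iff_modEq hdvd, ZMod.val_natCast_of_lt hcd]
        simpa [Nat.ModEq, Nat.mod_eq_of_lt hc, w] using hj
      · intro a b _ _ hab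
        exact e.symm.injective (Subtype.ext hab)
      · rintro i ⟨hi, hi'⟩
        refine ⟨e ⟨i, hi⟩, ?_, by simp⟩
        rw [sub_mem_zmultiples_iff_modEq hdvd, ZMod.val_natCast_of_lt hcd] at hi'
        simpa [Nat.ModEq, Nat.mod_eq_of_lt hc, w] using hi'
    have hpt := pow_pos hp.pos t
    have h1 := h (p ^ t) hdvd c
    rw [hcount, Nat.ceilDiv_eq_add_pred_div, Set.mem_insert_iff, Set.mem_singleton_iff] at h1
    have h2 : (Ω.card + p ^ t - 1) / p ^ t ≤ Ω.card / p ^ t + 1 := by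
      rw [← Nat.add_div_right _ hpt]
      exact Nat.div_le_div_right (Nat.sub_le _ _)
    have h3 : Ω.card / p ^ t ≤ (Ω.card + p ^ t - 1) / p ^ t :=
      Nat.div_le_div_right (by omega)
    omega
  have hzero := eq_zero_of_eval_rootsOfUnity_eq_zero (k := k) hp hdet
    (x := fun l => (ZMod.stdAddChar (s l) : ℂ)) (u := fun j => u (e.symm j))
    (fun a b hab => hs (ZMod.injective_stdAddChar hab))
    (fun l => by
      rw [← AddChar.map_nsmul_eq_pow, ← hd, nsmul_eq_mul, ZMod.natCast_self, zero_mul,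
        AddChar.map_zero_eq_one])
    (fun l => by
      have h0 := hu l
      rw [← Finset.sum_coe_sort,
        ← Equiv.sum_comp e.symm fun i : Ω => u i * (ZMod.stdAddChar (s l * (i : ZMod d)) : ℂ)] at h0
      refine (Finset.sum_congr rfl fun j _ => ?_).trans h0
      rw [← AddChar.map_nsmul_eq_pow, nsmul_eq_mul, ZMod.natCast_zmod_val, mul_comm (s l)])
  intro i hi
  simpa using congrFun hzero (e ⟨i, hi⟩)

/-- For a prime modulus the only divisors are `1` and `d`, whose cosets are the whole group and the
singletons. -/
theorem uniformlyDistributedOverDivisors_of_prime (hd : d.Prime) (Ω : Finset (ZMod d)) :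
    UniformlyDistributedOverDivisors Ω := by
  intro m hm c
  rcases (Nat.dvd_prime hd).mp hm with rfl | rfl
  · left
    have : {i : ZMod d | i ∈ Ω ∧ i - c ∈ AddSubgroup.zmultiples ((1 : ℕ) : ZMod d)} = Ω := by
      ext i
      have : i - c ∈ AddSubgroup.zmultiples ((1 : ℕ) : ZMod d) := by
        rw [sub_mem_zmultiples_iff_modEq (one_dvd d)]
        exact Nat.modEq_one
      exact ⟨fun h => h.1, fun h => ⟨h, this⟩⟩
    rw [this, Set.ncard_coe_finset, Nat.div_one]
  · have hset : {i : ZMod m | i ∈ Ω ∧ i - c ∈ AddSubgroup.zmultiples (m : ZMod m)} =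
        {i | i ∈ Ω ∧ i = c} := by
      ext i
      simp [sub_eq_zero, eq_comm]
    have hm0 := hd.pos
    have hle : Ω.card ≤ m := by simpa [ZMod.card] using Ω.card_le_univ
    rw [hset, Nat.ceilDiv_eq_add_pred_div, Set.mem_insert_iff, Set.mem_singleton_iff]
    by_cases hc : c ∈ Ω
    · right
      have h1 : {i | i ∈ Ω ∧ i = c} = {c} := by
        ext i
        simp only [Set.mem_ofPred_eq, Set.mem_singleton_iff]
        exact ⟨fun h => h.2, fun h => ⟨h ▸ hc, h⟩⟩
      have hpos := Finset.card_pos.mpr ⟨c, hc⟩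
      rw [h1, Set.ncard_singleton]
      exact (Nat.div_eq_of_lt_le (by omega) (by omega)).symm
    · left
      have h1 : {i | i ∈ Ω ∧ i = c} = ∅ := by
        ext i
        simp only [Set.mem_ofPred_eq, Set.mem_empty_iff_false, iff_false]
        exact fun h => hc (h.2 ▸ h.1)
      have hlt : Ω.card < m := by
        simpa [ZMod.card] using Finset.card_lt_univ_of_notMem hc
      rw [h1, Set.ncard_empty, Nat.div_eq_of_lt hlt]

/-! ### Universal sampling and frames -/

/-- A level set of the symbol has at most `L` elements, so its characters are among `L` characters
that are independent on `Ω`. -/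
theorem IsUniversalSampling.isFiniteFrame_samplingSystem (hL : L ≤ d)
    (h : IsUniversalSampling L Ω) {A : Module.End ℂ (EuclideanSpace ℂ (ZMod d))}
    (hA : A ∈ convolutionClass d L) : IsFiniteFrame (samplingSystem A Ω) := by
  obtain ⟨⟨a, rfl⟩, hM⟩ := hA
  have hgr := maxGeomMultiplicity_of_diagonal _ (circularConvolution_characterBasis a)
  rw [hM] at hgr
  rw [isFiniteFrame_samplingSystem_iff]
  intro c hc
  ext ξ₀
  -- Enlarge the level set of the symbol through `ξ₀` to a set of exactly `L` frequencies.
  have hcard : (Finset.univ.filter fun ξ => 𝓕 a ξ = 𝓕 a ξ₀).card ≤ L := hgr.2 ⟨ξ₀, rfl⟩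
  obtain ⟨S, hS, hSL⟩ := Finset.exists_superset_card_eq hcard (by simpa [ZMod.card] using hL)
  let e := S.equivFinOfCardEq hSL
  have h0 := h (fun l => (e.symm l : ZMod d))
    (fun a b hab => e.symm.injective (Subtype.ext hab))
    (fun l => if 𝓕 a (e.symm l) = 𝓕 a ξ₀ then c (e.symm l) else 0) (fun i hi => by
      have h1 := hc i hi (𝓕 a ξ₀)
      rw [Equiv.sum_comp e.symm (fun ξ : S =>
          (if 𝓕 a ξ = 𝓕 a ξ₀ then c ξ else 0) * (ZMod.stdAddChar ((ξ : ZMod d) * i) : ℂ)),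
        Finset.sum_coe_sort S (fun ξ =>
          (if 𝓕 a ξ = 𝓕 a ξ₀ then c ξ else 0) * (ZMod.stdAddChar (ξ * i) : ℂ))]
      rw [← Finset.sum_subset hS fun ξ _ hξ => by
        rw [if_neg (by simpa using hξ), zero_mul]]
      refine (Finset.sum_congr rfl fun ξ hξ => ?_).trans h1
      rw [if_pos (Finset.mem_filter.mp hξ).2])
  have := congrFun h0 (e ⟨ξ₀, hS (by simp)⟩)
  simpa using this

/-- Any `L` frequencies form a level set of the symbol of some operator in the class. -/
theorem isUniversalSampling_of_forall_isFiniteFrame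
    (h : ∀ A ∈ convolutionClass d L, IsFiniteFrame (samplingSystem A Ω)) :
    IsUniversalSampling L Ω := by
  classical
  intro s hs v hv
  rcases Nat.eq_zero_or_pos L with rfl | hL
  · exact Subsingleton.elim _ _
  -- A symbol whose level sets are the given set of frequencies and singletons.
  let S := Finset.univ.image s
  let σ : ZMod d → ℂ := fun ξ => if ξ ∈ S then 0 else (ξ.val : ℂ) + 1
  have hσ0 : ∀ ξ, σ ξ = 0 ↔ ξ ∈ S := by
    intro ξ
    by_cases hξ : ξ ∈ S
    · simp [σ, hξ]
    · simp only [σ, hξ, if_false, iff_false]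
      exact Nat.cast_add_one_ne_zero _
  have hS : (Finset.univ.filter fun ξ => σ ξ = 0) = S := by
    ext ξ
    simp [hσ0]
  have hScard : S.card = L := by
    simp [S, Finset.card_image_of_injective _ hs]
  let a := 𝓕⁻ σ
  have ha : 𝓕 a = σ := ZMod.dft.apply_symm_apply σ
  have hmem : circularConvolution a ∈ convolutionClass d L := by
    refine ⟨⟨a, rfl⟩, ?_⟩
    have hgr := maxGeomMultiplicity_of_diagonal _ (circularConvolution_characterBasis a)
    rw [ha] at hgr
    refine hgr.unique ⟨⟨s ⟨0, hL⟩, ?_⟩, ?_⟩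
    · have : σ (s ⟨0, hL⟩) = 0 := (hσ0 _).mpr (Finset.mem_image_of_mem _ (Finset.mem_univ _))
      simp only [this, hS, hScard]
    · rintro _ ⟨ξ, rfl⟩
      change (Finset.univ.filter fun η => σ η = σ ξ).card ≤ L
      by_cases hξ : ξ ∈ S
      · rw [(hσ0 ξ).mpr hξ, hS, hScard]
      · refine le_trans (Finset.card_le_one.mpr fun η hη η' hη' => ?_) hL
        have key : ∀ η ∈ Finset.univ.filter (fun η => σ η = σ ξ), η = ξ := by
          intro η hη
          have h1 : σ η = σ ξ := (Finset.mem_filter.mp hη).2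
          have h2 : η ∉ S := fun hη' => hξ ((hσ0 ξ).mp (h1 ▸ (hσ0 η).mpr hη'))
          simp only [σ, hξ, h2, if_false, add_left_inj, Nat.cast_inj] at h1
          exact ZMod.val_injective d h1
        rw [key η hη, key η' hη']
  have hc := (isFiniteFrame_samplingSystem_iff a Ω).mp (h _ hmem)
    (fun ξ => ∑ l, if s l = ξ then v l else 0) (fun i hi μ => ?_)
  · ext l
    have := congrFun hc (s l)
    simpa [hs.eq_iff] using this
  · have hc0 : ∀ ξ, ξ ∉ S → (∑ l, if s l = ξ then v l else 0) = 0 := fun ξ hξ =>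
      Finset.sum_eq_zero fun l _ => if_neg fun hl : s l = ξ =>
        hξ (hl ▸ Finset.mem_image_of_mem _ (Finset.mem_univ _))
    rw [ha]
    rcases eq_or_ne μ 0 with rfl | hμ
    · rw [hS, Finset.sum_image hs.injOn]
      simpa [hs.eq_iff] using hv i hi
    · refine Finset.sum_eq_zero fun ξ hξ => ?_
      rw [hc0 ξ fun hξS => hμ ((Finset.mem_filter.mp hξ).2 ▸ (hσ0 ξ).mpr hξS), zero_mul]

end

theorem mainTheorem7 (d L : ℕ) [NeZero d] (Ω : Finset (ZMod d)) (hΩ : Ω.card = L) :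
    (d.Prime → ∀ A ∈ convolutionClass d L, IsFiniteFrame (samplingSystem A Ω)) ∧
    ((∃ p k : ℕ, p.Prime ∧ d = p ^ k) →
      ((∀ A ∈ convolutionClass d L, IsFiniteFrame (samplingSystem A Ω)) ↔
        UniformlyDistributedOverDivisors Ω)) := by
  subst hΩ
  have hL : Ω.card ≤ d := by simpa [ZMod.card] using Ω.card_le_univ
  have hpow : ∀ p k : ℕ, p.Prime → d = p ^ k → UniformlyDistributedOverDivisors Ω →
      ∀ A ∈ convolutionClass d Ω.card, IsFiniteFrame (samplingSystem A Ω) :=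
    fun p k hp hd h A hA => (h.isUniversalSampling hp hd).isFiniteFrame_samplingSystem hL hA
  refine ⟨fun hd => hpow d 1 hd (pow_one d).symm (uniformlyDistributedOverDivisors_of_prime hd Ω),
    ?_⟩
  rintro ⟨p, k, hp, hd⟩
  exact ⟨fun h => (isUniversalSampling_of_forall_isFiniteFrame h).uniformlyDistributedOverDivisors,
    hpow p k hp hd⟩
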